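/- Consider a library of $n$ items and a cache of size $m$, $1\le m<n$. Requests are independent, each being for item $i$ with probability $p_i$, where $p_1\ge p_2\ge\dots\ge p_n>0$ and $\sum_{i=1}^n p_i=1$. A cache state is a vector $x=(x_1,\dots,x_m)$ of distinct items, $x_j$ being the item in position $j$. Under both FIFO and RANDOM a request for a cached item leaves the state unchanged. When an item $i$ that is not in the cache is requested, FIFO changes $(x_1,\dots,x_m)$ into $(i,x_1,\dots,x_{m-1})$, while RANDOM chooses a position $j$ uniformly among the $m$ positions and replaces $x_j$ by $i$. Each algorithm thus defines a Markov chain on the set of cache states, with one step per request; for RANDOM one may also record only the set $\{x_1,\dots,x_m\}$, which is again a Markov chain. The mixing time $t_{\mathrm{mix}}$ of a chain with transition matrix $P$ and unique stationary distribution $\pi$ is the least integer $t\ge 0$ such that $\max_x \tfrac12\sum_y|P^t(x,y)-\pi(y)|\le\tfrac12$. **Theorem.** There is an absolute constant $C>0$ such that for all $n$, $m$, $p$ as above the following holds. The RANDOM chain, both on cache vectors and on cache sets, has a unique stationary distribution and a finite mixing time, and, if $m=1$ or $n\ge m+2$, so does the FIFO chain. In each of these cases $$t_{\mathrm{mix}}\le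 C\,\frac{n^{2m}\left(\prod_{i=1}^m p_i\right)^6}{p_n^2\left(\prod_{i=n-m+1}^n p_i\right)^6}\,\ln\!\left(\frac{n^m\prod_{i=1}^m p_i}{\prod_{i=n-m+1}^n p_i}\right).$$ (For $n=m+1$ and $m\ge2$ the FIFO chain is not irreducible, so it has no unique stationary distribution.) -/

import Mathlib

open scoped Matrix

/-! Finite Markov chains: stationary distributions, total variation, mixing times. -/

/-- `π` is a stationary probability distribution of the transition matrix `P`. -/
def IsStationaryDist {S : Type*} [Fintype S] (P : Matrix S S ℝ) (π : S → ℝ) : Prop :=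
  (∀ x, 0 ≤ π x) ∧ ∑ x, π x = 1 ∧ π ᵥ* P = π

/-- Total variation distance of two distributions on a finite set. -/
noncomputable def tvDist {S : Type*} [Fintype S] (μ ν : S → ℝ) : ℝ :=
  (1 / 2) * ∑ x, |μ x - ν x|

/-- `t` is the mixing time `t_mix(ε)` of `P`: the chain has exactly one stationary distribution
`π`, and `t` is the least number of steps after which, from every initial state, the law of the
chain is within total variation distance `ε` of `π`.  No `t` satisfies this if the stationary
distribution is not unique or if the distance `ε` is never reached. -/
def IsMixingTime {S : Type*} [Fintype S] [DecidableEq S] (P : Matrix S S ℝ) (ε : ℝ) (t : ℕ) :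
    Prop :=
  ∃ π : S → ℝ, IsStationaryDist P π ∧ (∀ π' : S → ℝ, IsStationaryDist P π' → π' = π) ∧
    IsLeast {s : ℕ | ∀ x : S, tvDist ((P ^ s) x) π ≤ ε} t

/-! Cache states.  The library is `Fin n` (item `i + 1` of the usual numbering is `i : Fin n`),
and the positions of the cache are `Fin m`, position `0` being the first one. -/

/-- A cache state: the vector of the `m` distinct items held in the `m` positions. -/
abbrev CacheState (n m : ℕ) : Type := Fin m ↪ Fin n

/-- A cache content: the set of the `m` items held, irrespective of their positions. -/
abbrev CacheContent (n m : ℕ) : Type := {s : Finset (Fin n) // s.card = m}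

/-- The state after a missing item `i` has been inserted in the first position: all items move
one position further and the item in the last position is evicted. -/
def CacheState.pushFront {n m : ℕ} (x : CacheState n m) (i : Fin n) (hi : i ∉ Set.range x) :
    CacheState n m where
  toFun j := if (j : ℕ) = 0 then i else x ⟨(j : ℕ) - 1, by omega⟩
  inj' := by
    intro j k hjk
    simp only at hjk
    split_ifs at hjk with h1 h2 h2
    · exact Fin.ext (by omega)
    · exact absurd ⟨_, hjk.symm⟩ hi
    · exact absurd ⟨_, hjk⟩ hi
    · have := congrArg Fin.val (x.injective hjk)
      simp only at this
      exact Fin.ext (by omega)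

/-- The state after a missing item `i` has replaced the item in position `j`. -/
def CacheState.replaceAt {n m : ℕ} (x : CacheState n m) (j : Fin m) (i : Fin n)
    (hi : i ∉ Set.range x) : CacheState n m where
  toFun := Function.update x j i
  inj' := by
    intro k l hkl
    simp only [Function.update_apply] at hkl
    split_ifs at hkl with h1 h2 h2
    · exact h1.trans h2.symm
    · exact absurd ⟨_, hkl.symm⟩ hi
    · exact absurd ⟨_, hkl⟩ hi
    · exact x.injective hkl

/-! Transition matrices under the independent reference model: each request is for item `i` with
probability `p i`, independently of the past, and there is one transition per request. -/

open Classical in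
/-- FIFO: a hit changes nothing; on a miss the requested item enters at the first position, the
others move one position further, and the item in the last position is evicted. -/
noncomputable def fifoMatrix {n : ℕ} (m : ℕ) (p : Fin n → ℝ) :
    Matrix (CacheState n m) (CacheState n m) ℝ :=
  fun x y => ∑ i, p i *
    (if hi : i ∈ Set.range x then (if y = x then 1 else 0)
     else (if y = x.pushFront i hi then 1 else 0))

open Classical in
/-- RANDOM: a hit changes nothing; on a miss the requested item replaces the item in a position
chosen uniformly at random among the `m` positions. -/
noncomputable def randomMatrix {n : ℕ} (m : ℕ) (p : Fin n → ℝ) :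
    Matrix (CacheState n m) (CacheState n m) ℝ :=
  fun x y => ∑ i, p i *
    (if hi : i ∈ Set.range x then (if y = x then 1 else 0)
     else ∑ j : Fin m, (1 / (m : ℝ)) * (if y = x.replaceAt j i hi then 1 else 0))

/-- RANDOM, recording only the set of the cached items: a hit changes nothing; on a miss the
requested item replaces a cached item chosen uniformly at random. -/
noncomputable def randomSetMatrix {n : ℕ} (m : ℕ) (p : Fin n → ℝ) :
    Matrix (CacheContent n m) (CacheContent n m) ℝ :=
  fun s t => ∑ i, p i *
    (if i ∈ s.1 then (if t = s then 1 else 0)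
     else ∑ j ∈ s.1, (1 / (m : ℝ)) * (if t.1 = insert i (s.1.erase j) then 1 else 0))

/-- The product `p₁ ⋯ p_m` of the `m` largest popularities, for nonincreasing `p`. -/
noncomputable def topProd {n : ℕ} (m : ℕ) (p : Fin n → ℝ) : ℝ :=
  ∏ i ∈ (Finset.univ : Finset (Fin n)).filter (fun i : Fin n => (i : ℕ) < m), p i

/-- The product `p_{n-m+1} ⋯ p_n` of the `m` smallest popularities, for nonincreasing `p` and
`m ≤ n`. -/
noncomputable def bottomProd {n : ℕ} (m : ℕ) (p : Fin n → ℝ) : ℝ :=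
  ∏ i ∈ (Finset.univ : Finset (Fin n)).filter (fun i : Fin n => n - m ≤ (i : ℕ)), p i

/-- The quantity under the `O`, where `p ⟨n - 1, _⟩` is the smallest popularity `p_n`. -/
noncomputable def mixBound {n : ℕ} (m : ℕ) (hmn : m < n) (p : Fin n → ℝ) : ℝ :=
  (n : ℝ) ^ (2 * m) * topProd m p ^ 6 / (p ⟨n - 1, by omega⟩ ^ 2 * bottomProd m p ^ 6) *
    Real.log ((n : ℝ) ^ m * topProd m p / bottomProd m p)

/-! ### Convergence of finite Markov chains with a Poincaré inequality -/

/-! Call a state together with a requested item outside the cache a miss. If the evicted item is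
recorded as well, each replacement rule (the FIFO shift, or RANDOM's replacement at a fixed
position) becomes a permutation of the finite set of misses. It preserves the product of the
popularities of the cached and requested items. Hence `π x ∝ ∏ j, p (x j)` is stationary for FIFO
and RANDOM alike (`sum_cacheWeight_mul_missMatrix`).

FIFO is not reversible in general, so the rate comes from holding. A hit occurs with probability at
least `m * p_n`, and this turns the one-step loss of variance into a multiple of the Dirichlet form
(`holding_mul_le_local_variance`). A path argument in the undirected graph of misses gives a
Poincaré inequality (`mul_sq_sub_le_of_connected`). Together they contract the variance by `1 - lam`
with `lam = p_n ^ 2 / (2 * |S| * N)`, where `|S|` is the number of states and `N = n ^ m * topProd /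
bottomProd`, so that `1 / N` is a lower bound for `π`. About `log N / lam` steps suffice
(`missMatrix_mixing`).

Connectedness comes from generators of the symmetric group (`connected_of_closure_eq_top`). The
chain on sets is a lumping of the chain on vectors, which does not increase the distance. -/

theorem SimpleGraph.Walk.sub_eq_sum_darts {V : Type*} {G : SimpleGraph V} (f : V → ℝ) {a b : V}
    (w : G.Walk a b) : f b - f a = (w.darts.map fun d => f d.snd - f d.fst).sum := by
  induction w with
  | nil => simp
  | cons h w ih => simp [← ih]

section Chain

variable {S : Type*} [Fintype S]

/-- The Poincaré inequality obtained from a path between two vertices, all of whose edges carry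
at least the flow `q` in one of the two directions. -/
theorem mul_sq_sub_le_of_connected {G : SimpleGraph S} (hG : G.Connected) {Q : S → S → ℝ} {q : ℝ}
    (hQ : ∀ x y, 0 ≤ Q x y) (hq : 0 ≤ q) (hedge : ∀ x y, G.Adj x y → q ≤ Q x y ∨ q ≤ Q y x)
    (f : S → ℝ) (a b : S) :
    q * (f b - f a) ^ 2 ≤ 2 * Fintype.card S * ∑ x, ∑ y, Q x y * (f y - f x) ^ 2 := by
  classical
  obtain ⟨w, hw⟩ := (hG.preconnected a b).exists_isPath
  have hnd : w.darts.Nodup := SimpleGraph.Walk.darts_nodup_of_support_nodup hw.support_nodup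
  have hlen : (w.darts.toFinset.card : ℝ) ≤ Fintype.card S := by
    rw [List.toFinset_card_of_nodup hnd, w.length_darts]
    exact_mod_cast hw.length_lt.le
  have hsum : f b - f a = ∑ d ∈ w.darts.toFinset, (f d.snd - f d.fst) := by
    rw [w.sub_eq_sum_darts f, List.sum_toFinset _ hnd]
  have hcs : (f b - f a) ^ 2 ≤
      w.darts.toFinset.card * ∑ d ∈ w.darts.toFinset, (f d.snd - f d.fst) ^ 2 := by
    rw [hsum]
    exact sq_sum_le_card_mul_sum_sq
  -- A path repeats no dart, so its edge terms form a subsum of the sum over all pairs. Symmetrizing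
  -- `Q` covers flow in either direction and costs the factor 2.
  have hflow : q * ∑ d ∈ w.darts.toFinset, (f d.snd - f d.fst) ^ 2 ≤
      ∑ z : S × S, (Q z.1 z.2 + Q z.2 z.1) * (f z.2 - f z.1) ^ 2 := by
    rw [Finset.mul_sum]
    calc ∑ d ∈ w.darts.toFinset, q * (f d.snd - f d.fst) ^ 2
        ≤ ∑ d ∈ w.darts.toFinset,
            (Q d.toProd.1 d.toProd.2 + Q d.toProd.2 d.toProd.1) *
              (f d.toProd.2 - f d.toProd.1) ^ 2 := by
          refine Finset.sum_le_sum fun d _ => mul_le_mul_of_nonneg_right ?_ (sq_nonneg _)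
          rcases hedge _ _ d.adj with h | h
          · linarith [hQ d.snd d.fst]
          · linarith [hQ d.fst d.snd]
      _ = ∑ z ∈ w.darts.toFinset.image (fun d => d.toProd),
            (Q z.1 z.2 + Q z.2 z.1) * (f z.2 - f z.1) ^ 2 := by
          rw [Finset.sum_image]
          exact fun d _ d' _ h => SimpleGraph.Dart.ext _ _ h
      _ ≤ _ := Finset.sum_le_sum_of_subset_of_nonneg (Finset.subset_univ _) fun z _ _ =>
          mul_nonneg (add_nonneg (hQ _ _) (hQ _ _)) (sq_nonneg _)
  have hdouble : ∑ z : S × S, (Q z.1 z.2 + Q z.2 z.1) * (f z.2 - f z.1) ^ 2 =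
      2 * ∑ x, ∑ y, Q x y * (f y - f x) ^ 2 := by
    have hswap : ∑ x, ∑ y, Q y x * (f y - f x) ^ 2 = ∑ x, ∑ y, Q x y * (f y - f x) ^ 2 := by
      rw [Finset.sum_comm]
      exact Finset.sum_congr rfl fun x _ => Finset.sum_congr rfl fun y _ => by ring
    rw [Fintype.sum_prod_type]
    simp only [add_mul, Finset.sum_add_distrib]
    rw [hswap]
    ring
  calc q * (f b - f a) ^ 2
      ≤ q * (w.darts.toFinset.card * ∑ d ∈ w.darts.toFinset, (f d.snd - f d.fst) ^ 2) :=
        mul_le_mul_of_nonneg_left hcs hq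
    _ = w.darts.toFinset.card * (q * ∑ d ∈ w.darts.toFinset, (f d.snd - f d.fst) ^ 2) := by ring
    _ ≤ Fintype.card S * (2 * ∑ x, ∑ y, Q x y * (f y - f x) ^ 2) :=
        mul_le_mul hlen (hflow.trans_eq hdouble)
          (mul_nonneg hq (Finset.sum_nonneg fun _ _ => sq_nonneg _)) (Nat.cast_nonneg _)
    _ = _ := by ring

/-- The variance lost in one step of the chain from a state with holding probability `≥ h`. -/
theorem holding_mul_le_local_variance {r : S → ℝ} (hr : ∀ y, 0 ≤ r y) (hr1 : ∑ y, r y = 1)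
    {h : ℝ} {x : S} (hx : h ≤ r x) (f : S → ℝ) :
    h * ∑ y, r y * (f y - f x) ^ 2 ≤ ∑ y, r y * f y ^ 2 - (∑ y, r y * f y) ^ 2 := by
  classical
  have hshift : ∑ y, r y * f y ^ 2 - (∑ y, r y * f y) ^ 2 =
      ∑ y, r y * (f y - f x) ^ 2 - (∑ y, r y * (f y - f x)) ^ 2 := by
    have h1 : ∑ y, r y * (f y - f x) = ∑ y, r y * f y - f x := by
      simp only [mul_sub, Finset.sum_sub_distrib, ← Finset.sum_mul, hr1, one_mul]
    have h2 : ∑ y, r y * (f y - f x) ^ 2 =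
        ∑ y, r y * f y ^ 2 - 2 * f x * ∑ y, r y * f y + f x ^ 2 := by
      have : ∀ y, r y * (f y - f x) ^ 2 =
          r y * f y ^ 2 - 2 * f x * (r y * f y) + r y * f x ^ 2 := fun y => by ring
      simp only [this, Finset.sum_add_distrib, Finset.sum_sub_distrib, ← Finset.mul_sum,
        ← Finset.sum_mul, hr1, one_mul]
    rw [h1, h2]
    ring
  have hA : ∀ g : S → ℝ, g x = 0 → ∑ y, g y = ∑ y ∈ Finset.univ.erase x, g y := fun g hg =>
    (Finset.sum_erase _ hg).symm
  have hmass : ∑ y ∈ Finset.univ.erase x, r y ≤ 1 - h := by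
    have := Finset.add_sum_erase Finset.univ r (Finset.mem_univ x)
    linarith
  -- The term `y = x` vanishes, so Cauchy–Schwarz only sees the mass off `x`, which is at most `1 -
  -- h`.
  have hcs : (∑ y, r y * (f y - f x)) ^ 2 ≤
      (∑ y ∈ Finset.univ.erase x, r y) * ∑ y, r y * (f y - f x) ^ 2 := by
    rw [hA _ (by simp), hA (fun y => r y * (f y - f x) ^ 2) (by simp)]
    exact Finset.sum_sq_le_sum_mul_sum_of_sq_le_mul _ (fun y _ => hr y)
      (fun y _ => mul_nonneg (hr y) (sq_nonneg _)) fun y _ => le_of_eq (by ring)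
  have hnn : 0 ≤ ∑ y, r y * (f y - f x) ^ 2 :=
    Finset.sum_nonneg fun y _ => mul_nonneg (hr y) (sq_nonneg _)
  rw [hshift]
  nlinarith [mul_le_mul_of_nonneg_right hmass hnn]

/-- The action of a stochastic matrix contracts the variance, if the chain has holding
probabilities `≥ h` and its flow is `≥ q` along the edges of a connected graph. -/
theorem sum_mul_mulVec_sq_le {G : SimpleGraph S} (hG : G.Connected) {P : Matrix S S ℝ}
    {π : S → ℝ} (hπ : IsStationaryDist P π) (hP : ∀ x y, 0 ≤ P x y) (hrow : ∀ x, ∑ y, P x y = 1)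
    {h q : ℝ} (hh : 0 ≤ h) (hq : 0 ≤ q) (hhold : ∀ x, h ≤ P x x)
    (hedge : ∀ x y, G.Adj x y → q ≤ π x * P x y ∨ q ≤ π y * P y x)
    {f : S → ℝ} (hf : ∑ x, π x * f x = 0) :
    ∑ x, π x * (P *ᵥ f) x ^ 2 ≤
      (1 - h * q / (2 * Fintype.card S)) * ∑ x, π x * f x ^ 2 := by
  obtain ⟨hπ0, hπ1, hπP⟩ := hπ
  have hne : Nonempty S := hG.nonempty
  have hc : (0 : ℝ) < 2 * Fintype.card S := by
    have : 0 < Fintype.card S := Fintype.card_pos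
    positivity
  set D : ℝ := ∑ x, ∑ y, π x * P x y * (f y - f x) ^ 2 with hD
  set V : ℝ := ∑ x, π x * f x ^ 2 with hV
  -- By stationarity the loss is the `π`-average of the variances of `f` under the rows of `P`;
  -- reversibility plays no role.
  have hloss : h * D ≤ V - ∑ x, π x * (P *ᵥ f) x ^ 2 := by
    have hVP : V = ∑ x, π x * ∑ y, P x y * f y ^ 2 := by
      rw [hV]
      conv_lhs => rw [← hπP]
      simp only [Matrix.vecMul, dotProduct, Finset.sum_mul, Finset.mul_sum]
      rw [Finset.sum_comm]
      exact Finset.sum_congr rfl fun x _ => Finset.sum_congr rfl fun y _ => by ring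
    rw [hVP, hD, Finset.mul_sum, ← Finset.sum_sub_distrib]
    refine Finset.sum_le_sum fun x _ => ?_
    have := mul_le_mul_of_nonneg_left
      (holding_mul_le_local_variance (hP x) (hrow x) (hhold x) f) (hπ0 x)
    calc h * ∑ y, π x * P x y * (f y - f x) ^ 2
        = π x * (h * ∑ y, P x y * (f y - f x) ^ 2) := by
          simp only [mul_assoc, ← Finset.mul_sum]
          ring
      _ ≤ _ := this
      _ = _ := by simp only [Matrix.mulVec, dotProduct]; ring
  have hpt : ∀ x, q * f x ^ 2 ≤ 2 * Fintype.card S * D := by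
    intro x
    have hVnn : 0 ≤ V := Finset.sum_nonneg fun y _ => mul_nonneg (hπ0 y) (sq_nonneg _)
    have hexp : ∑ y, π y * (f x - f y) ^ 2 = f x ^ 2 + V := by
      have : ∀ y, π y * (f x - f y) ^ 2 =
          π y * f x ^ 2 - 2 * f x * (π y * f y) + π y * f y ^ 2 := fun y => by ring
      simp only [this, Finset.sum_add_distrib, Finset.sum_sub_distrib, ← Finset.mul_sum,
        ← Finset.sum_mul, hπ1, hf, ← hV]
      ring
    calc q * f x ^ 2 ≤ q * ∑ y, π y * (f x - f y) ^ 2 := by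
          rw [hexp]
          exact mul_le_mul_of_nonneg_left (by linarith) hq
      _ = ∑ y, π y * (q * (f x - f y) ^ 2) := by
          rw [Finset.mul_sum]
          exact Finset.sum_congr rfl fun y _ => by ring
      _ ≤ ∑ y, π y * (2 * Fintype.card S * D) :=
          Finset.sum_le_sum fun y _ => mul_le_mul_of_nonneg_left
            (mul_sq_sub_le_of_connected hG (fun x y => mul_nonneg (hπ0 x) (hP x y)) hq hedge f y x)
            (hπ0 y)
      _ = 2 * Fintype.card S * D := by rw [← Finset.sum_mul, hπ1, one_mul]
  have hVD : q * V ≤ 2 * Fintype.card S * D := by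
    calc q * V = ∑ x, π x * (q * f x ^ 2) := by
          rw [hV, Finset.mul_sum]
          exact Finset.sum_congr rfl fun y _ => by ring
      _ ≤ ∑ x, π x * (2 * Fintype.card S * D) :=
          Finset.sum_le_sum fun x _ => mul_le_mul_of_nonneg_left (hpt x) (hπ0 x)
      _ = 2 * Fintype.card S * D := by rw [← Finset.sum_mul, hπ1, one_mul]
  have hgap : h * q / (2 * Fintype.card S) * V ≤ h * D := by
    rw [div_mul_eq_mul_div, div_le_iff₀ hc]
    nlinarith [mul_le_mul_of_nonneg_left hVD hh]
  linarith

/-! ### From variance decay to total variation, uniqueness and mixing times. -/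

variable [DecidableEq S]

theorem sum_mul_pow_mulVec_sq_le {P : Matrix S S ℝ} {π : S → ℝ} (hπP : π ᵥ* P = π) {ρ : ℝ}
    (hρ : 0 ≤ ρ)
    (hcontr : ∀ f : S → ℝ, ∑ x, π x * f x = 0 →
      ∑ x, π x * (P *ᵥ f) x ^ 2 ≤ ρ * ∑ x, π x * f x ^ 2)
    {f : S → ℝ} (hf : ∑ x, π x * f x = 0) (t : ℕ) :
    ∑ x, π x * ((P ^ t) *ᵥ f) x ^ 2 ≤ ρ ^ t * ∑ x, π x * f x ^ 2 := by
  have hpow : ∀ t : ℕ, π ᵥ* P ^ t = π := by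
    intro t
    induction t with
    | zero => simp
    | succ t ih => rw [pow_succ, ← Matrix.vecMul_vecMul, ih, hπP]
  induction t with
  | zero => simp
  | succ t ih =>
    have hmean : ∑ x, π x * ((P ^ t) *ᵥ f) x = 0 := by
      change π ⬝ᵥ ((P ^ t) *ᵥ f) = 0
      rw [Matrix.dotProduct_mulVec, hpow]
      exact hf
    rw [pow_succ', ← Matrix.mulVec_mulVec, pow_succ', mul_assoc]
    exact (hcontr _ hmean).trans (mul_le_mul_of_nonneg_left ih hρ)

/-- Exponential convergence in total variation from a contraction of the variance. -/
theorem two_mul_tvDist_sq_le {P : Matrix S S ℝ} {π : S → ℝ} (hπ : IsStationaryDist P π)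
    (hrow : ∀ x, ∑ y, P x y = 1) {ρ μ : ℝ} (hρ : 0 ≤ ρ) (hμ : 0 < μ) (hmin : ∀ x, μ ≤ π x)
    (hcontr : ∀ f : S → ℝ, ∑ x, π x * f x = 0 →
      ∑ x, π x * (P *ᵥ f) x ^ 2 ≤ ρ * ∑ x, π x * f x ^ 2) (t : ℕ) (x : S) :
    (2 * tvDist ((P ^ t) x) π) ^ 2 ≤ (Fintype.card S : ℝ) ^ 2 * ρ ^ t / μ := by
  obtain ⟨hπ0, hπ1, hπP⟩ := hπ
  have hrowt : (P ^ t) *ᵥ (fun _ => (1 : ℝ)) = fun _ => 1 := by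
    induction t with
    | zero => simp
    | succ t ih =>
      rw [pow_succ, ← Matrix.mulVec_mulVec]
      have : P *ᵥ (fun _ => (1 : ℝ)) = fun _ => 1 := by
        ext x
        simp [Matrix.mulVec, dotProduct, hrow]
      rw [this, ih]
  have hpt : ∀ y, ((P ^ t) x y - π y) ^ 2 ≤ ρ ^ t / μ := by
    intro y
    -- The centred indicator of `y`: its image under `P ^ t`, evaluated at `x`, is exactly the
    -- deviation to be bounded.
    set f : S → ℝ := fun z => (if z = y then 1 else 0) - π y with hf
    have hmean : ∑ z, π z * f z = 0 := by
      simp [hf, mul_sub, ← Finset.sum_mul, hπ1]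
    have hfx : ((P ^ t) *ᵥ f) x = (P ^ t) x y - π y := by
      have h1 := congrFun hrowt x
      simp only [Matrix.mulVec, dotProduct, mul_one] at h1
      simp [Matrix.mulVec, dotProduct, hf, mul_sub, ← Finset.sum_mul, h1]
    have hπle : π y ≤ 1 := hπ1 ▸ Finset.single_le_sum (fun z _ => hπ0 z) (Finset.mem_univ y)
    have hvar : ∑ z, π z * f z ^ 2 ≤ 1 := by
      rw [← hπ1]
      refine Finset.sum_le_sum fun z _ => mul_le_of_le_one_right (hπ0 z) ?_
      have := hπ0 y
      simp only [hf]
      split_ifs <;> nlinarith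
    have h2 := sum_mul_pow_mulVec_sq_le hπP hρ hcontr hmean t
    have h3 : π x * ((P ^ t) *ᵥ f) x ^ 2 ≤ ∑ z, π z * ((P ^ t) *ᵥ f) z ^ 2 :=
      Finset.single_le_sum (f := fun z => π z * ((P ^ t) *ᵥ f) z ^ 2)
        (fun z _ => mul_nonneg (hπ0 z) (sq_nonneg _)) (Finset.mem_univ x)
    rw [hfx] at h3
    rw [le_div_iff₀ hμ]
    calc ((P ^ t) x y - π y) ^ 2 * μ ≤ π x * ((P ^ t) x y - π y) ^ 2 := by
          rw [mul_comm]
          exact mul_le_mul_of_nonneg_right (hmin x) (sq_nonneg _)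
      _ ≤ ρ ^ t * ∑ z, π z * f z ^ 2 := h3.trans h2
      _ ≤ ρ ^ t := mul_le_of_le_one_right (pow_nonneg hρ t) hvar
  calc (2 * tvDist ((P ^ t) x) π) ^ 2 = (∑ y, |(P ^ t) x y - π y|) ^ 2 := by
        rw [tvDist]
        ring
    _ ≤ (Finset.univ : Finset S).card * ∑ y, |(P ^ t) x y - π y| ^ 2 := sq_sum_le_card_mul_sum_sq
    _ ≤ (Finset.univ : Finset S).card * ∑ y : S, ρ ^ t / μ := by
        gcongr with y
        rw [sq_abs]
        exact hpt y
    _ = _ := by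
        simp only [Finset.sum_const, Finset.card_univ, nsmul_eq_mul]
        ring

omit [DecidableEq S] in
theorem tvDist_nonneg (μ ν : S → ℝ) : 0 ≤ tvDist μ ν :=
  mul_nonneg (by norm_num) (Finset.sum_nonneg fun _ _ => abs_nonneg _)

open Filter Topology in
/-- The stationary distribution is unique if the chain converges to it from every state. -/
theorem IsStationaryDist.eq_of_tendsto {P : Matrix S S ℝ} {π π' : S → ℝ}
    (hlim : ∀ x, Tendsto (fun t => tvDist ((P ^ t) x) π) atTop (𝓝 0))
    (hπ' : IsStationaryDist P π') : π' = π := by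
  obtain ⟨h0, h1, hP⟩ := hπ'
  have hpow : ∀ t : ℕ, π' ᵥ* P ^ t = π' := by
    intro t
    induction t with
    | zero => simp
    | succ t ih => rw [pow_succ, ← Matrix.vecMul_vecMul, ih, hP]
  ext y
  have hbound : ∀ t : ℕ, |π' y - π y| ≤ ∑ x, π' x * (2 * tvDist ((P ^ t) x) π) := by
    intro t
    have : π' y - π y = ∑ x, π' x * ((P ^ t) x y - π y) := by
      conv_lhs => rw [← hpow t]
      simp [Matrix.vecMul, dotProduct, mul_sub, ← Finset.sum_mul, h1]
    rw [this]
    refine (Finset.abs_sum_le_sum_abs _ _).trans (Finset.sum_le_sum fun x _ => ?_)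
    rw [abs_mul, abs_of_nonneg (h0 x)]
    refine mul_le_mul_of_nonneg_left ?_ (h0 x)
    have := Finset.single_le_sum (f := fun y => |(P ^ t) x y - π y|) (fun _ _ => abs_nonneg _)
      (Finset.mem_univ y)
    simp only [tvDist]
    linarith
  have hz : Tendsto (fun t => ∑ x, π' x * (2 * tvDist ((P ^ t) x) π)) atTop (𝓝 0) := by
    have := tendsto_finsetSum (Finset.univ : Finset S)
      fun x _ => ((hlim x).const_mul 2).const_mul (π' x)
    simpa using this
  have := ge_of_tendsto' hz hbound
  exact sub_eq_zero.mp (abs_nonpos_iff.mp this)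

open Filter Topology in
theorem exists_isMixingTime_le {P : Matrix S S ℝ} {π : S → ℝ} (hπ : IsStationaryDist P π)
    (hlim : ∀ x, Tendsto (fun t => tvDist ((P ^ t) x) π) atTop (𝓝 0)) {ε : ℝ} {t₀ : ℕ}
    (ht₀ : ∀ x, tvDist ((P ^ t₀) x) π ≤ ε) : ∃ t, IsMixingTime P ε t ∧ t ≤ t₀ := by
  classical
  have hex : ∃ s : ℕ, ∀ x : S, tvDist ((P ^ s) x) π ≤ ε := ⟨t₀, ht₀⟩
  exact ⟨Nat.find hex, ⟨π, hπ, fun π' hπ' => hπ'.eq_of_tendsto hlim, Nat.find_spec hex,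
    fun s hs => Nat.find_min' hex hs⟩, Nat.find_min' hex ht₀⟩

/-! ### Lumping -/

section Lump

variable {T : Type*} [Fintype T] [DecidableEq T] {P : Matrix S S ℝ} {R : Matrix T T ℝ} {φ : S → T}

/-- The hypothesis is strong lumpability: the mass sent to a fibre depends only on the fibre of the
starting point. It therefore passes to powers. -/
theorem lump_pow (hφ : ∀ x u, ∑ y with φ y = u, P x y = R (φ x) u) (t : ℕ) (x : S) (u : T) :
    ∑ y with φ y = u, (P ^ t) x y = (R ^ t) (φ x) u := by
  induction t generalizing x with
  | zero => simp [Matrix.one_apply, Finset.sum_ite_eq]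
  | succ t ih =>
    simp only [pow_succ', Matrix.mul_apply]
    rw [Finset.sum_comm]
    simp only [← Finset.mul_sum, ih]
    rw [← Finset.sum_fiberwise_of_maps_to (s := Finset.univ) (t := Finset.univ) (g := φ)
      (fun _ _ => Finset.mem_univ _)]
    refine Finset.sum_congr rfl fun v _ => ?_
    rw [← hφ x v, Finset.sum_mul]
    refine Finset.sum_congr rfl fun z hz => ?_
    rw [(Finset.mem_filter.mp hz).2]

omit [DecidableEq S] in
theorem IsStationaryDist.lump {π : S → ℝ} (hφ : ∀ x u, ∑ y with φ y = u, P x y = R (φ x) u)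
    (hπ : IsStationaryDist P π) : IsStationaryDist R fun u => ∑ y with φ y = u, π y := by
  obtain ⟨h0, h1, hP⟩ := hπ
  refine ⟨fun u => Finset.sum_nonneg fun y _ => h0 y, ?_, ?_⟩
  · rw [Finset.sum_fiberwise, h1]
  · ext u
    conv_rhs => rw [← hP]
    simp only [Matrix.vecMul, dotProduct]
    rw [Finset.sum_comm]
    simp only [← Finset.mul_sum, hφ]
    rw [← Finset.sum_fiberwise_of_maps_to (s := Finset.univ) (t := Finset.univ) (g := φ)
      (fun _ _ => Finset.mem_univ _)]
    refine Finset.sum_congr rfl fun v _ => ?_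
    rw [Finset.sum_mul]
    refine Finset.sum_congr rfl fun z hz => ?_
    rw [(Finset.mem_filter.mp hz).2]

theorem tvDist_lump_le {π : S → ℝ} (hφ : ∀ x u, ∑ y with φ y = u, P x y = R (φ x) u)
    (t : ℕ) (x : S) :
    tvDist ((R ^ t) (φ x)) (fun u => ∑ y with φ y = u, π y) ≤ tvDist ((P ^ t) x) π := by
  refine mul_le_mul_of_nonneg_left ?_ (by norm_num)
  rw [← Finset.sum_fiberwise Finset.univ φ fun y => |(P ^ t) x y - π y|]
  refine Finset.sum_le_sum fun u _ => ?_
  rw [← lump_pow hφ, ← Finset.sum_sub_distrib]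
  exact Finset.abs_sum_le_sum_abs _ _

end Lump

end Chain

/-! ### Chains that move only on misses -/

/-- A miss: a cache state together with a requested item that is not cached. -/
abbrev CacheMiss (n m : ℕ) : Type :=
  {q : CacheState n m × Fin n // q.2 ∉ Set.range q.1}

/-- The product of the popularities of the cached items. -/
noncomputable def cacheWeight {n m : ℕ} (p : Fin n → ℝ) (x : CacheState n m) : ℝ :=
  ∏ j, p (x j)

/-- The product of the popularities of the cached items and of the requested item. -/
noncomputable def missWeight {n m : ℕ} (p : Fin n → ℝ) (q : CacheMiss n m) : ℝ :=
  cacheWeight p q.1.1 * p q.1.2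

open Classical in
/-- A hit changes nothing; on a miss a rule `k` is chosen with probability `c k`, and `e k` maps
the miss to the new state and the evicted item. -/
noncomputable def missMatrix {n m : ℕ} {K : Type*} [Fintype K] (c : K → ℝ)
    (e : K → CacheMiss n m → CacheMiss n m) (p : Fin n → ℝ) :
    Matrix (CacheState n m) (CacheState n m) ℝ :=
  fun x y => ∑ i, p i *
    (if hi : i ∈ Set.range x then (if y = x then 1 else 0)
     else ∑ k, c k * (if y = (e k ⟨(x, i), hi⟩).1.1 then 1 else 0))

/-- Two states are joined if some miss leads from one to the other. -/
def missGraph {n m : ℕ} {K : Type*} (e : K → CacheMiss n m → CacheMiss n m) :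
    SimpleGraph (CacheState n m) :=
  SimpleGraph.fromRel fun x y => ∃ (k : K) (q : CacheMiss n m), q.1.1 = x ∧ (e k q).1.1 = y

section MissMatrix

variable {n m : ℕ} {K : Type*} {c : K → ℝ} {e : K → CacheMiss n m → CacheMiss n m}
  {p : Fin n → ℝ}

theorem missGraph_reachable (k : K) (q : CacheMiss n m) :
    (missGraph e).Reachable q.1.1 (e k q).1.1 := by
  by_cases h : q.1.1 = (e k q).1.1
  · rw [← h]
  · exact SimpleGraph.Adj.reachable
      ((SimpleGraph.fromRel_adj _ _ _).mpr ⟨h, Or.inl ⟨k, q, rfl, rfl⟩⟩)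

theorem cacheWeight_pos (hp : ∀ i, 0 < p i) (x : CacheState n m) : 0 < cacheWeight p x :=
  Finset.prod_pos fun _ _ => hp _

variable [Fintype K]

theorem missMatrix_nonneg (hc : ∀ k, 0 ≤ c k) (hp : ∀ i, 0 < p i) (x y : CacheState n m) :
    0 ≤ missMatrix c e p x y := by
  refine Finset.sum_nonneg fun i _ => mul_nonneg (hp i).le ?_
  split_ifs
  · exact zero_le_one
  · exact le_rfl
  · exact Finset.sum_nonneg fun k _ => mul_nonneg (hc k) (by split_ifs <;> norm_num)

theorem missMatrix_row_sum (hc1 : ∑ k, c k = 1) (hp1 : ∑ i, p i = 1) (x : CacheState n m) :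
    ∑ y, missMatrix c e p x y = 1 := by
  classical
  simp only [missMatrix]
  rw [Finset.sum_comm]
  refine (Finset.sum_congr rfl fun i _ => ?_).trans hp1
  rw [← Finset.mul_sum]
  split_ifs
  · simp
  · rw [Finset.sum_comm]
    simp [hc1]

/-- Each of the `m` cached items, when requested, leaves the state fixed. -/
theorem le_missMatrix_self (hc : ∀ k, 0 ≤ c k) (hp : ∀ i, 0 < p i) {r : ℝ} (hr : ∀ i, r ≤ p i)
    (x : CacheState n m) : m * r ≤ missMatrix c e p x x := by
  classical
  have h1 : ∑ i ∈ Finset.univ.map x, p i ≤ missMatrix c e p x x := by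
    rw [missMatrix]
    refine (Finset.sum_le_sum fun i hi => ?_).trans
      (Finset.sum_le_sum_of_subset_of_nonneg (Finset.subset_univ (Finset.univ.map x))
        fun i _ _ => ?_)
    · have : i ∈ Set.range x := by simpa using hi
      rw [dif_pos this, if_pos rfl, mul_one]
    · refine mul_nonneg (hp i).le ?_
      split_ifs with h1 h2
      · exact zero_le_one
      · exact absurd rfl h2
      · exact Finset.sum_nonneg fun k _ => mul_nonneg (hc k) (by split_ifs <;> norm_num)
  refine le_trans ?_ h1
  rw [Finset.sum_map]
  calc (m : ℝ) * r = ∑ _j : Fin m, r := by simp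
    _ ≤ _ := Finset.sum_le_sum fun j _ => hr _

theorem le_missMatrix_of_miss (hc : ∀ k, 0 ≤ c k) (hp : ∀ i, 0 < p i) (k : K)
    (q : CacheMiss n m) : p q.1.2 * c k ≤ missMatrix c e p q.1.1 (e k q).1.1 := by
  classical
  obtain ⟨⟨x, i⟩, hi⟩ := q
  have h0 : ∀ i' ∈ Finset.univ, 0 ≤ p i' *
      (if hi' : i' ∈ Set.range x then (if (e k ⟨(x, i), hi⟩).1.1 = x then (1 : ℝ) else 0)
       else ∑ k', c k' * (if (e k ⟨(x, i), hi⟩).1.1 = (e k' ⟨(x, i'), hi'⟩).1.1 then 1 else 0)) := by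
    intro i' _
    refine mul_nonneg (hp i').le ?_
    split_ifs
    · exact zero_le_one
    · exact le_rfl
    · exact Finset.sum_nonneg fun k _ => mul_nonneg (hc k) (by split_ifs <;> norm_num)
  refine le_trans ?_ (Finset.single_le_sum h0 (Finset.mem_univ i))
  rw [dif_neg hi]
  refine mul_le_mul_of_nonneg_left ?_ (hp i).le
  refine le_trans ?_ (Finset.single_le_sum (fun k' _ => ?_) (Finset.mem_univ k))
  · simp
  · exact mul_nonneg (hc k') (by split_ifs <;> norm_num)

/-- The product form is invariant if every rule permutes the misses and preserves their weights. -/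
theorem sum_cacheWeight_mul_missMatrix (hc1 : ∑ k, c k = 1) (hp1 : ∑ i, p i = 1)
    (he : ∀ k, Function.Injective (e k)) (hw : ∀ k q, missWeight p (e k q) = missWeight p q)
    (y : CacheState n m) : ∑ x, cacheWeight p x * missMatrix c e p x y = cacheWeight p y := by
  classical
  -- For each rule `k`, reindexing the misses along the bijection `e k` removes the rule, since
  -- weights are preserved; the `c k` then sum to 1.
  have hmiss : ∑ q : CacheMiss n m,
        missWeight p q * ∑ k, c k * (if y = (e k q).1.1 then 1 else 0) =
      ∑ q : CacheMiss n m, missWeight p q * (if y = q.1.1 then 1 else 0) := by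
    simp only [Finset.mul_sum]
    rw [Finset.sum_comm]
    have hk : ∀ k, ∑ q : CacheMiss n m,
          missWeight p q * (c k * (if y = (e k q).1.1 then 1 else 0)) =
        c k * ∑ q : CacheMiss n m, missWeight p q * (if y = q.1.1 then 1 else 0) := by
      intro k
      rw [← (Finite.injective_iff_bijective.mp (he k)).sum_comp
        fun q : CacheMiss n m => missWeight p q * (if y = q.1.1 then 1 else 0), Finset.mul_sum]
      refine Finset.sum_congr rfl fun q _ => ?_
      rw [hw]
      ring
    simp only [hk, ← Finset.sum_mul, hc1, one_mul]
  calc ∑ x, cacheWeight p x * missMatrix c e p x y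
      = ∑ z : CacheState n m × Fin n, (if hz : z.2 ∈ Set.range z.1 then
          cacheWeight p z.1 * p z.2 * (if y = z.1 then 1 else 0) else
          missWeight p ⟨z, hz⟩ * ∑ k, c k * (if y = (e k ⟨z, hz⟩).1.1 then 1 else 0)) := by
        rw [Fintype.sum_prod_type]
        refine Finset.sum_congr rfl fun x _ => ?_
        rw [missMatrix, Finset.mul_sum]
        refine Finset.sum_congr rfl fun i _ => ?_
        split_ifs <;> simp only [missWeight] <;> ring
    _ = ∑ z : CacheState n m × Fin n, (if _hz : z.2 ∈ Set.range z.1 then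
          cacheWeight p z.1 * p z.2 * (if y = z.1 then 1 else 0) else
          cacheWeight p z.1 * p z.2 * (if y = z.1 then 1 else 0)) := by
        rw [← Fintype.sum_subtype_add_sum_subtype (fun z : CacheState n m × Fin n => z.2 ∈ Set.range z.1),
          ← Fintype.sum_subtype_add_sum_subtype (fun z : CacheState n m × Fin n => z.2 ∈ Set.range z.1)
            (fun z : CacheState n m × Fin n => dite _ _ _)]
        refine congrArg₂ _ (Finset.sum_congr rfl fun z _ => by simp only [z.2, dite_true])
          (((Finset.sum_congr rfl fun z _ => ?_).trans hmiss).trans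
            (Finset.sum_congr rfl fun z _ => ?_))
        · rw [dif_neg z.2]
        · rw [dif_neg z.2]
          rfl
    _ = ∑ x, ∑ i, cacheWeight p x * p i * (if y = x then 1 else 0) := by
        rw [Fintype.sum_prod_type]
        simp
    _ = cacheWeight p y := by
        simp [← Finset.mul_sum, hp1]

theorem isStationaryDist_missMatrix [Nonempty (CacheState n m)] (hc1 : ∑ k, c k = 1)
    (hp : ∀ i, 0 < p i) (hp1 : ∑ i, p i = 1)
    (he : ∀ k, Function.Injective (e k)) (hw : ∀ k q, missWeight p (e k q) = missWeight p q) :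
    IsStationaryDist (missMatrix c e p)
      (fun x => cacheWeight p x / ∑ z : CacheState n m, cacheWeight p z) := by
  have hZ : 0 < ∑ z : CacheState n m, cacheWeight p z :=
    Finset.sum_pos (fun z _ => cacheWeight_pos hp z) Finset.univ_nonempty
  refine ⟨fun x => (div_pos (cacheWeight_pos hp x) hZ).le, ?_, ?_⟩
  · rw [← Finset.sum_div, div_self hZ.ne']
  · ext y
    simp only [Matrix.vecMul, dotProduct, div_mul_eq_mul_div]
    rw [← Finset.sum_div, sum_cacheWeight_mul_missMatrix hc1 hp1 he hw]

end MissMatrix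

/-! ### Weights of cache states -/

section Weight

variable {n m : ℕ} {p : Fin n → ℝ}

/-- The weight ignores positions, so the cached items may be listed increasingly. This allows
comparison with the extremal products factor by factor. -/
theorem exists_strictMono_cacheWeight_eq (p : Fin n → ℝ) (x : CacheState n m) :
    ∃ f : Fin m → Fin n, StrictMono f ∧ cacheWeight p x = ∏ j, p (f j) := by
  have hcard : (Finset.univ.map x).card = m := by simp
  refine ⟨(Finset.univ.map x).orderEmbOfFin hcard, OrderEmbedding.strictMono _, ?_⟩
  have h1 : ∏ j, p ((Finset.univ.map x).orderEmbOfFin hcard j) =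
      ∏ i ∈ Finset.univ.map ((Finset.univ.map x).orderEmbOfFin hcard).toEmbedding, p i := by
    rw [Finset.prod_map]
    rfl
  rw [h1, Finset.map_orderEmbOfFin_univ, Finset.prod_map]
  rfl

theorem StrictMono.fin_val_le {f : Fin m → Fin n} (hf : StrictMono f) (j : Fin m) :
    (j : ℕ) ≤ f j := by
  obtain ⟨j, hj⟩ := j
  induction j with
  | zero => simp
  | succ j ih =>
    have h1 := ih (by omega)
    have h2 : f ⟨j, by omega⟩ < f ⟨j + 1, hj⟩ := hf (by simp)
    have h3 : (f ⟨j, by omega⟩ : ℕ) < f ⟨j + 1, hj⟩ := h2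
    simp only at h1 ⊢
    omega

theorem topProd_eq (hmn : m < n) (p : Fin n → ℝ) :
    topProd m p = ∏ j : Fin m, p ⟨j, by omega⟩ := by
  symm
  refine Finset.prod_bij (fun j _ => ⟨j, by omega⟩) ?_ ?_ ?_ ?_
  · simp
  · intro a _ b _ h
    simpa [Fin.ext_iff] using h
  · intro b hb
    exact ⟨⟨b, by simpa using hb⟩, Finset.mem_univ _, rfl⟩
  · simp

theorem bottomProd_eq (hmn : m < n) (p : Fin n → ℝ) :
    bottomProd m p = ∏ j : Fin m, p ⟨n - m + j, by omega⟩ := by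
  symm
  refine Finset.prod_bij (fun j _ => ⟨n - m + j, by omega⟩) ?_ ?_ ?_ ?_
  · intro j _
    simp only [Finset.mem_filter, Finset.mem_univ, true_and]
    omega
  · intro a _ b _ h
    simpa [Fin.ext_iff] using h
  · intro b hb
    have hb' : n - m ≤ (b : ℕ) := by simpa using hb
    exact ⟨⟨b - (n - m), by omega⟩, Finset.mem_univ _, Fin.ext (by simp; omega)⟩
  · simp

theorem cacheWeight_le_topProd (hmn : m < n) (hp : ∀ i, 0 < p i) (hanti : Antitone p)
    (x : CacheState n m) : cacheWeight p x ≤ topProd m p := by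
  obtain ⟨f, hf, hx⟩ := exists_strictMono_cacheWeight_eq p x
  rw [hx, topProd_eq hmn]
  exact Finset.prod_le_prod (fun j _ => (hp _).le) fun j _ => hanti (hf.fin_val_le j)

theorem bottomProd_le_cacheWeight (hmn : m < n) (hp : ∀ i, 0 < p i) (hanti : Antitone p)
    (x : CacheState n m) : bottomProd m p ≤ cacheWeight p x := by
  obtain ⟨f, hf, hx⟩ := exists_strictMono_cacheWeight_eq p x
  rw [hx, bottomProd_eq hmn]
  refine Finset.prod_le_prod (fun j _ => (hp _).le) fun j _ => hanti ?_
  -- Reversing both the positions and the items turns the lower bound on a strictly increasing map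
  -- into the upper bound needed here.
  have hg : StrictMono fun k : Fin m => (f k.rev).rev := fun a b hab =>
    Fin.rev_lt_rev.mpr (hf (Fin.rev_lt_rev.mpr hab))
  have := hg.fin_val_le j.rev
  simp only [Fin.rev_rev, Fin.val_rev] at this
  rw [Fin.le_def]
  simp only
  omega

theorem bottomProd_pos (hp : ∀ i, 0 < p i) : 0 < bottomProd m p :=
  Finset.prod_pos fun _ _ => hp _

end Weight

/-! ### The mixing bound -/

section Bound

open Filter Topology

theorem tendsto_tvDist_of_sq_le {S : Type*} [Fintype S] [DecidableEq S] {P : Matrix S S ℝ}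
    {π : S → ℝ} {a b ρ : ℝ} (hρ : 0 ≤ ρ) (hρ1 : ρ < 1) {x : S}
    (h : ∀ t : ℕ, (2 * tvDist ((P ^ t) x) π) ^ 2 ≤ a * ρ ^ t / b) :
    Tendsto (fun t => tvDist ((P ^ t) x) π) atTop (𝓝 0) := by
  have h1 : Tendsto (fun t : ℕ => a * ρ ^ t / b) atTop (𝓝 0) := by
    simpa using ((tendsto_pow_atTop_nhds_zero_of_lt_one hρ hρ1).const_mul a).div_const b
  have h2 : Tendsto (fun t : ℕ => (2 * tvDist ((P ^ t) x) π) ^ 2) atTop (𝓝 0) :=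
    squeeze_zero (fun t => sq_nonneg _) h h1
  have h3 := (h2.sqrt).div_const 2
  simp only [Real.sqrt_zero, zero_div] at h3
  refine h3.congr fun t => ?_
  rw [Real.sqrt_sq (mul_nonneg zero_le_two (tvDist_nonneg _ _))]
  ring

/-- The number of steps that makes a rate `1 - lam` win over a factor `N ^ 3`. -/
theorem exists_nat_pow_mul_le_one {N lam : ℝ} (hN : 2 ≤ N) (hlam : 0 < lam) (hlam1 : lam ≤ 1) :
    ∃ t : ℕ, N ^ 3 * (1 - lam) ^ t ≤ 1 ∧ (t : ℝ) ≤ 6 * (Real.log N / lam) := by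
  -- This makes `3 * (Real.log N / lam)` at least 1, so rounding up at most doubles it: hence the 6.
  have hlog : 1 / 2 ≤ Real.log N :=
    (by linarith [Real.log_two_gt_d9] : (1 / 2 : ℝ) ≤ Real.log 2).trans
      (Real.log_le_log two_pos hN)
  have hdiv : Real.log N ≤ Real.log N / lam := by
    rw [le_div_iff₀ hlam]
    nlinarith
  refine ⟨⌈3 * (Real.log N / lam)⌉₊, ?_, ?_⟩
  · set t := ⌈3 * (Real.log N / lam)⌉₊
    have ht : 3 * (Real.log N / lam) ≤ t := Nat.le_ceil _
    have ht' : 3 * Real.log N ≤ lam * t := by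
      have h2 := mul_le_mul_of_nonneg_left ht hlam.le
      have h3 : lam * (3 * (Real.log N / lam)) = 3 * Real.log N := by field_simp
      linarith
    have h1 : (1 - lam) ^ t ≤ Real.exp (-(lam * t)) := by
      calc (1 - lam) ^ t ≤ (Real.exp (-lam)) ^ t :=
            pow_le_pow_left₀ (by linarith) (Real.one_sub_le_exp_neg lam) t
        _ = _ := by
            rw [← Real.exp_nat_mul]
            ring_nf
    calc N ^ 3 * (1 - lam) ^ t ≤ Real.exp (3 * Real.log N) * Real.exp (-(lam * t)) := by
          refine mul_le_mul ?_ h1 (pow_nonneg (by linarith) t) (Real.exp_pos _).le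
          rw [show 3 * Real.log N = ((3 : ℕ) : ℝ) * Real.log N by norm_num, Real.exp_nat_mul,
            Real.exp_log (by linarith)]
      _ ≤ 1 := by
          rw [← Real.exp_add, Real.exp_le_one_iff]
          linarith
  · have := Nat.ceil_lt_add_one (a := 3 * (Real.log N / lam)) (by linarith)
    linarith

variable {n m : ℕ} {p : Fin n → ℝ}

theorem card_cacheState_le (n m : ℕ) : (Fintype.card (CacheState n m) : ℝ) ≤ (n : ℝ) ^ m := by
  rw [Fintype.card_embedding_eq, Fintype.card_fin, Fintype.card_fin]
  exact_mod_cast Nat.descFactorial_le_pow n m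

theorem two_le_pow_mul_div (hm : 1 ≤ m) (hmn : m < n) (hp : ∀ i, 0 < p i) (hanti : Antitone p)
    (x : CacheState n m) : 2 ≤ (n : ℝ) ^ m * topProd m p / bottomProd m p := by
  have hb := bottomProd_pos (m := m) hp
  have hbt : bottomProd m p ≤ topProd m p :=
    (bottomProd_le_cacheWeight hmn hp hanti x).trans (cacheWeight_le_topProd hmn hp hanti x)
  have hn : (2 : ℝ) ≤ (n : ℝ) ^ m := by
    have h2 : 2 ≤ n ^ m := (show 2 ≤ n by omega).trans (Nat.le_self_pow (by omega) n)
    exact_mod_cast h2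
  rw [le_div_iff₀ hb]
  nlinarith

/-- The normalizing sum has at most `n ^ m` terms, each at most `topProd`. -/
theorem inv_le_cacheWeight_div_sum (hmn : m < n) (hp : ∀ i, 0 < p i) (hanti : Antitone p)
    (x : CacheState n m) :
    ((n : ℝ) ^ m * topProd m p / bottomProd m p)⁻¹ ≤
      cacheWeight p x / ∑ z : CacheState n m, cacheWeight p z := by
  have hZ : 0 < ∑ z : CacheState n m, cacheWeight p z :=
    Finset.sum_pos (fun z _ => cacheWeight_pos hp z) ⟨x, Finset.mem_univ x⟩
  have hZle : ∑ z : CacheState n m, cacheWeight p z ≤ (n : ℝ) ^ m * topProd m p := by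
    calc ∑ z : CacheState n m, cacheWeight p z ≤ ∑ _z : CacheState n m, topProd m p :=
          Finset.sum_le_sum fun z _ => cacheWeight_le_topProd hmn hp hanti z
      _ = Fintype.card (CacheState n m) * topProd m p := by simp
      _ ≤ _ := mul_le_mul_of_nonneg_right (card_cacheState_le n m)
          (Finset.prod_nonneg fun i _ => (hp i).le)
  rw [inv_div]
  exact div_le_div₀ (cacheWeight_pos hp x).le (bottomProd_le_cacheWeight hmn hp hanti x) hZ hZle

/-- Convergence and mixing of a chain that moves only on misses. -/
theorem missMatrix_mixing {K : Type*} [Fintype K] {c : K → ℝ}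
    {e : K → CacheMiss n m → CacheMiss n m} (hm : 1 ≤ m) (hmn : m < n) (hp : ∀ i, 0 < p i)
    (hp1 : ∑ i, p i = 1) (hanti : Antitone p) (hc : ∀ k, 1 / (m : ℝ) ≤ c k)
    (hc1 : ∑ k, c k = 1) (he : ∀ k, Function.Injective (e k))
    (hw : ∀ k q, missWeight p (e k q) = missWeight p q) (hG : (missGraph e).Connected) :
    ∃ π : CacheState n m → ℝ, IsStationaryDist (missMatrix c e p) π ∧
      (∀ x, Tendsto (fun t => tvDist ((missMatrix c e p ^ t) x) π) atTop (𝓝 0)) ∧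
      ∃ t₀ : ℕ, (∀ x, tvDist ((missMatrix c e p ^ t₀) x) π ≤ 1 / 2) ∧
        (t₀ : ℝ) ≤ 12 * mixBound m hmn p := by
  have hne : Nonempty (CacheState n m) := hG.nonempty
  obtain ⟨x₀⟩ := id hne
  have hm0 : (0 : ℝ) < m := by exact_mod_cast hm
  have hc0 : ∀ k, 0 ≤ c k := fun k => (by positivity : (0 : ℝ) ≤ 1 / m).trans (hc k)
  set r : ℝ := p ⟨n - 1, by omega⟩ with hr
  have hr0 : 0 < r := hp _
  have hrle : ∀ i, r ≤ p i := fun i => hanti (Fin.le_def.mpr (by simp only; omega))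
  have hr1 : r ≤ 1 := hp1 ▸ Finset.single_le_sum (fun i _ => (hp i).le) (Finset.mem_univ _)
  have hb := bottomProd_pos (m := m) hp
  set R : ℝ := topProd m p / bottomProd m p with hR
  have hR1 : 1 ≤ R := by
    rw [hR, one_le_div hb]
    exact (bottomProd_le_cacheWeight hmn hp hanti x₀).trans
      (cacheWeight_le_topProd hmn hp hanti x₀)
  set N : ℝ := (n : ℝ) ^ m * topProd m p / bottomProd m p with hN
  have hNR : N = (n : ℝ) ^ m * R := mul_div_assoc _ _ _
  have hN2 : 2 ≤ N := two_le_pow_mul_div hm hmn hp hanti x₀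
  have hn1 : (1 : ℝ) ≤ (n : ℝ) ^ m := one_le_pow₀ (by exact_mod_cast (by omega : 1 ≤ n))
  set s : ℝ := (Fintype.card (CacheState n m) : ℝ) with hs
  have hs1 : 1 ≤ s := by
    rw [hs]
    exact_mod_cast Fintype.card_pos
  have hsn : s ≤ (n : ℝ) ^ m := card_cacheState_le n m
  set π : CacheState n m → ℝ :=
    fun x => cacheWeight p x / ∑ z : CacheState n m, cacheWeight p z with hπdef
  have hπ : IsStationaryDist (missMatrix c e p) π :=
    isStationaryDist_missMatrix hc1 hp hp1 he hw
  have hmin : ∀ x, N⁻¹ ≤ π x := inv_le_cacheWeight_div_sum hmn hp hanti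
  have hNinv : 0 < N⁻¹ := inv_pos.mpr (by linarith)
  have hflow : ∀ k (q : CacheMiss n m),
      N⁻¹ * (r * (1 / m)) ≤ π q.1.1 * missMatrix c e p q.1.1 (e k q).1.1 := fun k q =>
    mul_le_mul (hmin _)
      ((mul_le_mul (hrle _) (hc k) (by positivity) (hp _).le).trans
        (le_missMatrix_of_miss hc0 hp k q)) (by positivity) (hπ.1 _)
  have hedge : ∀ x y, (missGraph e).Adj x y →
      N⁻¹ * (r * (1 / m)) ≤ π x * missMatrix c e p x y ∨
        N⁻¹ * (r * (1 / m)) ≤ π y * missMatrix c e p y x := by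
    intro x y hxy
    rcases (SimpleGraph.fromRel_adj _ _ _).mp hxy with ⟨-, ⟨k, q, rfl, rfl⟩ | ⟨k, q, rfl, rfl⟩⟩
    · exact Or.inl (hflow k q)
    · exact Or.inr (hflow k q)
  -- Holding `m * r` times flow `N⁻¹ * (r / m)`: the factor `m` cancels.
  set lam : ℝ := m * r * (N⁻¹ * (r * (1 / m))) / (2 * s) with hlamdef
  have hlam : lam = r ^ 2 / (2 * s * N) := by
    rw [hlamdef]
    field_simp
  have hlam0 : 0 < lam := by
    rw [hlam]
    positivity
  have hlam_lt : lam < 1 := by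
    rw [hlam, div_lt_one (by positivity)]
    nlinarith
  have hdecay := two_mul_tvDist_sq_le (P := missMatrix c e p) hπ
    (missMatrix_row_sum hc1 hp1) (ρ := 1 - lam) (by linarith) hNinv hmin
    (fun f hf => sum_mul_mulVec_sq_le hG hπ (missMatrix_nonneg hc0 hp)
      (missMatrix_row_sum hc1 hp1) (by positivity) (by positivity)
      (le_missMatrix_self hc0 hp hrle) hedge hf)
  refine ⟨π, hπ, fun x => tendsto_tvDist_of_sq_le (by linarith) (by linarith)
    fun t => hdecay t x, ?_⟩
  obtain ⟨t, ht, htle⟩ := exists_nat_pow_mul_le_one hN2 hlam0 hlam_lt.le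
  refine ⟨t, fun x => ?_, htle.trans ?_⟩
  · have h1 : (2 * tvDist ((missMatrix c e p ^ t) x) π) ^ 2 ≤ 1 := by
      refine (hdecay t x).trans (le_trans ?_ ht)
      have hsN : s ≤ N := by
        rw [hNR]
        nlinarith
      rw [div_inv_eq_mul]
      have h0 : 0 ≤ (1 - lam) ^ t := pow_nonneg (by linarith) t
      calc s ^ 2 * (1 - lam) ^ t * N ≤ N ^ 2 * (1 - lam) ^ t * N := by gcongr
        _ = _ := by ring
    have := abs_le_of_sq_le_sq' (h1.trans_eq (one_pow 2).symm) zero_le_one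
    linarith [this.2]
  · have hlogN : 0 ≤ Real.log N := Real.log_nonneg (by linarith)
    have hbound : mixBound m hmn p = (n : ℝ) ^ (2 * m) * R ^ 6 / r ^ 2 * Real.log N := by
      rw [mixBound, hR, div_pow, ← hr]
      congr 1
      field_simp
    have h3 : Real.log N / lam = 2 * (s * N / r ^ 2 * Real.log N) := by
      rw [hlam]
      field_simp
    have h4 : s * N ≤ (n : ℝ) ^ (2 * m) * R ^ 6 := by
      -- The argument yields the first power of `R`; as `1 ≤ R`, the sixth power in the bound is
      -- weaker.
      rw [hNR, two_mul, pow_add, ← mul_assoc]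
      have h5 : R ≤ R ^ 6 := le_self_pow₀ hR1 (by norm_num)
      gcongr
    rw [hbound, h3]
    have : s * N / r ^ 2 * Real.log N ≤ (n : ℝ) ^ (2 * m) * R ^ 6 / r ^ 2 * Real.log N := by
      gcongr
    linarith

end Bound

/-! ### FIFO and RANDOM -/

section Rules

variable {n m : ℕ}

theorem CacheState.pushFront_apply (x : CacheState n m) (i : Fin n) (hi : i ∉ Set.range x)
    (j : Fin m) :
    x.pushFront i hi j = if (j : ℕ) = 0 then i else x ⟨(j : ℕ) - 1, by omega⟩ :=
  rfl

theorem CacheState.replaceAt_apply (x : CacheState n m) (j : Fin m) (i : Fin n)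
    (hi : i ∉ Set.range x) (k : Fin m) :
    x.replaceAt j i hi k = if k = j then i else x k :=
  Function.update_apply _ _ _ _

/-- The rule of FIFO, together with the evicted item. -/
def fifoRule (hm : 1 ≤ m) (q : CacheMiss n m) : CacheMiss n m :=
  ⟨(q.1.1.pushFront q.1.2 q.2, q.1.1 ⟨m - 1, by omega⟩), by
    rintro ⟨j, hj⟩
    simp only [CacheState.pushFront_apply] at hj
    split_ifs at hj with h0
    · exact q.2 ⟨_, hj.symm⟩
    · have := congrArg Fin.val (q.1.1.injective hj)
      simp only at this
      omega⟩

/-- The rule of RANDOM for the position `j`, together with the evicted item. -/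
def randomRule (j : Fin m) (q : CacheMiss n m) : CacheMiss n m :=
  ⟨(q.1.1.replaceAt j q.1.2 q.2, q.1.1 j), by
    rintro ⟨k, hk⟩
    simp only [CacheState.replaceAt_apply] at hk
    split_ifs at hk with h0
    · exact q.2 ⟨_, hk.symm⟩
    · exact h0 (q.1.1.injective hk)⟩

/-- The new state shows the requested item and all old positions but the last, which the evicted
item supplies. -/
theorem fifoRule_injective (hm : 1 ≤ m) :
    Function.Injective (fifoRule hm : CacheMiss n m → CacheMiss n m) := by
  rintro ⟨⟨x, i⟩, hi⟩ ⟨⟨x', i'⟩, hi'⟩ h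
  have h1 : x.pushFront i hi = x'.pushFront i' hi' := congrArg (fun q : CacheMiss n m => q.1.1) h
  have h2 : x ⟨m - 1, by omega⟩ = x' ⟨m - 1, by omega⟩ :=
    congrArg (fun q : CacheMiss n m => q.1.2) h
  have h3 : i = i' := by
    simpa [CacheState.pushFront_apply] using DFunLike.congr_fun h1 ⟨0, hm⟩
  have h4 : x = x' := by
    ext j : 1
    by_cases hj : (j : ℕ) + 1 < m
    · simpa [CacheState.pushFront_apply] using DFunLike.congr_fun h1 ⟨j + 1, hj⟩
    · have : j = ⟨m - 1, by omega⟩ := Fin.ext (by simp only; omega)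
      rw [this, h2]
  subst h3 h4
  rfl

theorem randomRule_involutive (j : Fin m) :
    Function.Involutive (randomRule j : CacheMiss n m → CacheMiss n m) := by
  rintro ⟨⟨x, i⟩, hi⟩
  refine Subtype.ext (Prod.ext ?_ ?_)
  · ext k : 1
    by_cases hk : k = j <;> simp [randomRule, CacheState.replaceAt_apply, hk]
  · simp [randomRule, CacheState.replaceAt_apply]

theorem missWeight_fifoRule (hm : 1 ≤ m) (p : Fin n → ℝ) (q : CacheMiss n m) :
    missWeight p (fifoRule hm q) = missWeight p q := by
  obtain ⟨⟨x, i⟩, hi⟩ := q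
  obtain ⟨k, rfl⟩ : ∃ k, m = k + 1 := ⟨m - 1, by omega⟩
  simp only [missWeight, cacheWeight, fifoRule]
  rw [Fin.prod_univ_succ, Fin.prod_univ_castSucc]
  simp only [CacheState.pushFront_apply, Fin.val_zero, if_true,
    Fin.val_succ, Nat.succ_ne_zero, if_false, Nat.add_sub_cancel]
  change p i * (∏ j : Fin k, p (x j.castSucc)) * p (x (Fin.last k)) = _
  ring

theorem missWeight_randomRule (p : Fin n → ℝ) (j : Fin m) (q : CacheMiss n m) :
    missWeight p (randomRule j q) = missWeight p q := by
  obtain ⟨⟨x, i⟩, hi⟩ := q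
  simp only [missWeight, cacheWeight, randomRule]
  rw [← Finset.mul_prod_erase Finset.univ _ (Finset.mem_univ j),
    ← Finset.mul_prod_erase Finset.univ (fun k => p (x k)) (Finset.mem_univ j)]
  have : ∏ k ∈ Finset.univ.erase j, p (x.replaceAt j i hi k) =
      ∏ k ∈ Finset.univ.erase j, p (x k) := by
    refine Finset.prod_congr rfl fun k hk => ?_
    rw [CacheState.replaceAt_apply, if_neg (Finset.ne_of_mem_erase hk)]
  rw [this]
  simp only [CacheState.replaceAt_apply, if_true]
  ring

theorem fifoMatrix_eq_missMatrix (hm : 1 ≤ m) (p : Fin n → ℝ) :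
    fifoMatrix m p = missMatrix (fun _ : Unit => 1) (fun _ => fifoRule hm) p := by
  ext x y
  simp only [fifoMatrix, missMatrix, fifoRule, Finset.univ_unique, Finset.sum_singleton, one_mul]
  rfl

theorem randomMatrix_eq_missMatrix (p : Fin n → ℝ) :
    randomMatrix m p = missMatrix (fun _ : Fin m => 1 / (m : ℝ)) randomRule p :=
  rfl

theorem fifoMatrix_one (p : Fin n → ℝ) : fifoMatrix 1 p = randomMatrix 1 p := by
  have : ∀ (x : CacheState n 1) (i : Fin n) (hi : i ∉ Set.range x),
      x.pushFront i hi = x.replaceAt 0 i hi := by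
    intro x i hi
    ext j : 1
    obtain rfl := Subsingleton.elim j 0
    simp [CacheState.pushFront_apply, CacheState.replaceAt_apply]
  ext x y
  simp only [fifoMatrix, randomMatrix, this, Finset.univ_unique, Finset.sum_singleton,
    Nat.cast_one, div_one, one_mul]
  rfl

end Rules

/-! ### Connectedness -/

section Connected

variable {n m : ℕ}

/-- The cache state formed by the first `m` values of a permutation. -/
def permState (h : m ≤ n) (g : Equiv.Perm (Fin n)) : CacheState n m :=
  (Fin.castLEEmb h).trans g.toEmbedding

@[simp]
theorem permState_apply (h : m ≤ n) (g : Equiv.Perm (Fin n)) (j : Fin m) :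
    permState h g j = g (Fin.castLE h j) :=
  rfl

theorem permState_surjective (h : m ≤ n) : Function.Surjective (permState (m := m) h) := by
  intro x
  obtain ⟨g, hg⟩ := (Equiv.Perm.isMultiplyPretransitive (Fin n) m).exists_smul_eq
    (Fin.castLEEmb h) x
  exact ⟨g, hg⟩

/-- Lifting states to permutations makes moves right multiplications. Reachability is symmetric and
transitive, so the multipliers that work from every `g` form a subgroup; checking generators is
enough. -/
theorem connected_of_closure_eq_top {G : SimpleGraph (CacheState n m)} (h : m ≤ n)
    {A : Set (Equiv.Perm (Fin n))} (hA : Subgroup.closure A = ⊤)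
    (hG : ∀ a ∈ A, ∀ g, G.Reachable (permState h g) (permState h (g * a))) : G.Connected := by
  have hall : ∀ a g : Equiv.Perm (Fin n), G.Reachable (permState h g) (permState h (g * a)) := by
    intro a
    have ha : a ∈ Subgroup.closure A := hA ▸ Subgroup.mem_top a
    induction ha using Subgroup.closure_induction with
    | mem a ha => exact hG a ha
    | one => exact fun g => by rw [mul_one]
    | mul a b _ _ iha ihb =>
      intro g
      rw [← mul_assoc]
      exact (iha g).trans (ihb (g * a))
    | inv a _ ih =>
      intro g
      have := ih (g * a⁻¹)
      rw [inv_mul_cancel_right] at this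
      exact this.symm
  have : Nonempty (CacheState n m) := ⟨permState h 1⟩
  refine ⟨fun x y => ?_⟩
  obtain ⟨g, rfl⟩ := permState_surjective h x
  obtain ⟨g', rfl⟩ := permState_surjective h y
  simpa using hall (g⁻¹ * g') g

theorem closure_swap_right_eq_top {α : Type*} [DecidableEq α] [Finite α] (l : α) :
    Subgroup.closure {σ : Equiv.Perm α | ∃ a, σ = Equiv.swap a l} = ⊤ := by
  rw [eq_top_iff, ← Equiv.Perm.closure_isSwap, Subgroup.closure_le]
  have hmem : ∀ a, Equiv.swap a l ∈
      Subgroup.closure {σ : Equiv.Perm α | ∃ a, σ = Equiv.swap a l} := fun a =>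
    Subgroup.subset_closure ⟨a, rfl⟩
  rintro _ ⟨a, b, hab, rfl⟩
  by_cases ha : a = l
  · rw [ha, Equiv.swap_comm]
    exact hmem b
  · by_cases hb : b = l
    · rw [hb]
      exact hmem a
    · have h3 := Equiv.swap_mul_swap_mul_swap (x := b) (y := l) (z := a) hb hab.symm
      rw [← h3, Equiv.swap_comm l a]
      exact mul_mem (mul_mem (hmem a) (hmem b)) (hmem a)

theorem missGraph_randomRule_connected (hmn : m < n) :
    (missGraph (randomRule : Fin m → CacheMiss n m → CacheMiss n m)).Connected := by
  refine connected_of_closure_eq_top hmn.le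
    (closure_swap_right_eq_top (⟨n - 1, by omega⟩ : Fin n)) ?_
  rintro _ ⟨a, rfl⟩ g
  set l : Fin n := ⟨n - 1, by omega⟩ with hl
  have hjl : ∀ j : Fin m, Fin.castLE hmn.le j ≠ l := fun j h => by
    have := congrArg Fin.val h
    simp only [Fin.val_castLE, hl] at this
    omega
  by_cases ha : (a : ℕ) < m
  -- Slot `l` lies outside the cache, so requesting `g l` and replacing position `a` realizes the
  -- transposition. If `a` is outside too, the state does not change.
  · have hi : g l ∉ Set.range (permState (m := m) hmn.le g) := by
      rintro ⟨j, hj⟩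
      exact hjl j (g.injective hj)
    have hnew : (randomRule ⟨a, ha⟩ ⟨(permState hmn.le g, g l), hi⟩).1.1 =
        permState hmn.le (g * Equiv.swap a l) := by
      ext j : 1
      simp only [randomRule, CacheState.replaceAt_apply, permState_apply, Equiv.Perm.mul_apply]
      split_ifs with hj
      · have : Fin.castLE hmn.le j = a := by rw [hj]; rfl
        rw [this, Equiv.swap_apply_left]
      · rw [Equiv.swap_apply_of_ne_of_ne _ (hjl j)]
        exact fun h => hj (Fin.ext (show (j : ℕ) = a from congrArg Fin.val h))
    rw [← hnew]
    exact missGraph_reachable (e := randomRule) ⟨a, ha⟩ ⟨(permState hmn.le g, g l), hi⟩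
  · have : permState (m := m) hmn.le (g * Equiv.swap a l) = permState hmn.le g := by
      ext j : 1
      rw [permState_apply, permState_apply, Equiv.Perm.mul_apply,
        Equiv.swap_apply_of_ne_of_ne _ (hjl j)]
      intro h
      have := congrArg Fin.val h
      simp only [Fin.val_castLE] at this
      omega
    rw [this]

theorem missGraph_fifoRule_connected (hm : 1 ≤ m) (hmn : m + 2 ≤ n) :
    (missGraph fun _ : Unit => (fifoRule hm : CacheMiss n m → CacheMiss n m)).Connected := by
  obtain ⟨k, rfl⟩ : ∃ k, n = k + 2 := ⟨n - 2, by omega⟩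
  have hle : m ≤ k + 2 := by omega
  -- The full cycle and the transposition of the last two slots generate the symmetric group. Both
  -- slots lie outside the cache because `m + 2 ≤ n`, so that transposition leaves the state fixed.
  refine connected_of_closure_eq_top hle
    (Equiv.Perm.closure_cycle_adjacent_swap isCycle_finRotate support_finRotate
      (⟨k, by omega⟩ : Fin (k + 2))) ?_
  have hlast : finRotate (k + 2) ⟨k, by omega⟩ = Fin.last (k + 1) :=
    finRotate_of_lt (by omega)
  rintro _ (rfl | rfl) g
  -- The FIFO move runs backwards: from `g * finRotate`, requesting the item in the last slot, which
  -- is `g 0`, leads to `g`.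
  · have hi : (g * finRotate (k + 2)) (Fin.last (k + 1)) ∉
        Set.range (permState (m := m) hle (g * finRotate (k + 2))) := by
      rintro ⟨j, hj⟩
      have : (j : ℕ) = k + 1 := congrArg Fin.val ((g * finRotate (k + 2)).injective hj)
      omega
    have hnew : (fifoRule hm ⟨(permState hle (g * finRotate (k + 2)), _), hi⟩).1.1 =
        permState hle g := by
      ext j : 1
      simp only [fifoRule, CacheState.pushFront_apply, permState_apply,
        Equiv.Perm.mul_apply]
      split_ifs with hj
      · rw [finRotate_last]
        congr 1
        exact Fin.ext hj.symm
      · congr 1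
        have hlt : (j : ℕ) - 1 < k + 1 := by omega
        refine (finRotate_of_lt hlt).trans (Fin.ext ?_)
        simp only [Fin.val_castLE]
        omega
    have := missGraph_reachable (e := fun _ : Unit => fifoRule hm) ()
      ⟨(permState hle (g * finRotate (k + 2)), _), hi⟩
    rw [hnew] at this
    exact this.symm
  · rw [hlast]
    have : permState (m := m) hle (g * Equiv.swap ⟨k, by omega⟩ (Fin.last (k + 1))) =
        permState hle g := by
      ext j : 1
      rw [permState_apply, permState_apply, Equiv.Perm.mul_apply, Equiv.swap_apply_of_ne_of_ne]
      · intro h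
        have := congrArg Fin.val h
        simp only [Fin.val_castLE] at this
        omega
      · intro h
        have := congrArg Fin.val h
        simp only [Fin.val_castLE, Fin.val_last] at this
        omega
    rw [this]

end Connected

/-! ### Cache contents -/

section Content

variable {n m : ℕ}

/-- The set of the cached items. -/
def CacheState.content (x : CacheState n m) : CacheContent n m :=
  ⟨Finset.univ.map x, by simp⟩

theorem CacheState.content_surjective :
    Function.Surjective (CacheState.content : CacheState n m → CacheContent n m) := by
  rintro ⟨s, hs⟩
  exact ⟨(s.orderEmbOfFin hs).toEmbedding, Subtype.ext (s.map_orderEmbOfFin_univ hs)⟩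

theorem CacheState.content_replaceAt (x : CacheState n m) (j : Fin m) (i : Fin n)
    (hi : i ∉ Set.range x) :
    (x.replaceAt j i hi).content.1 = insert i (x.content.1.erase (x j)) := by
  ext a
  simp only [CacheState.content, CacheState.replaceAt_apply, Finset.mem_map, Finset.mem_univ,
    true_and, Finset.mem_insert, Finset.mem_erase]
  constructor
  · rintro ⟨k, hk⟩
    split_ifs at hk with h
    · exact Or.inl hk.symm
    · exact Or.inr ⟨fun ha => h (x.injective (hk.trans ha)), k, hk⟩
  · rintro (rfl | ⟨ha, k, rfl⟩)
    · exact ⟨j, if_pos rfl⟩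
    · exact ⟨k, if_neg fun h => ha (congrArg x h)⟩

/-- A uniform position is a uniform cached item, and the new content depends only on the old content
and the two exchanged items. -/
theorem sum_randomMatrix_content (p : Fin n → ℝ) (x : CacheState n m) (u : CacheContent n m) :
    ∑ y with CacheState.content y = u, randomMatrix m p x y =
      randomSetMatrix m p x.content u := by
  classical
  simp only [randomMatrix, randomSetMatrix]
  rw [Finset.sum_comm]
  refine Finset.sum_congr rfl fun i _ => ?_
  rw [← Finset.mul_sum]
  congr 1
  have hmem : i ∈ x.content.1 ↔ i ∈ Set.range x := by simp [CacheState.content]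
  by_cases hi : i ∈ Set.range x
  · rw [if_pos (hmem.mpr hi)]
    simp only [dif_pos hi, Finset.sum_ite_eq', Finset.mem_filter, Finset.mem_univ, true_and]
    simp only [eq_comm]
  · rw [if_neg (mt hmem.mp hi)]
    simp only [dif_neg hi]
    rw [Finset.sum_comm, show x.content.1 = Finset.univ.map x from rfl, Finset.sum_map]
    refine Finset.sum_congr rfl fun j _ => ?_
    rw [← Finset.mul_sum, Finset.sum_ite_eq']
    simp only [Finset.mem_filter, Finset.mem_univ, true_and]
    have := x.content_replaceAt j i hi
    rw [show x.content.1 = Finset.univ.map x from rfl] at this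
    simp only [← this, Subtype.ext_iff, eq_comm]

end Content

/-! ### The mixing bound for the three chains. -/

theorem mainTheorem6 :
    ∃ C : ℝ, 0 < C ∧
      ∀ (n m : ℕ) (_hm : 1 ≤ m) (hmn : m < n) (p : Fin n → ℝ)
        (_hpos : ∀ i, 0 < p i) (_hsum : ∑ i, p i = 1) (_hanti : Antitone p),
        (∃ t : ℕ, IsMixingTime (randomMatrix m p) (1 / 2) t ∧ (t : ℝ) ≤ C * mixBound m hmn p) ∧
        (∃ t : ℕ, IsMixingTime (randomSetMatrix m p) (1 / 2) t ∧
          (t : ℝ) ≤ C * mixBound m hmn p) ∧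
        (m = 1 ∨ m + 2 ≤ n →
          ∃ t : ℕ, IsMixingTime (fifoMatrix m p) (1 / 2) t ∧ (t : ℝ) ≤ C * mixBound m hmn p) := by
  refine ⟨12, by norm_num, fun n m hm hmn p hp hp1 hanti => ?_⟩
  have hm0 : (1 : ℝ) ≤ m := by exact_mod_cast hm
  obtain ⟨π, hπ, hlim, t₀, ht₀, hle⟩ := missMatrix_mixing (c := fun _ : Fin m => 1 / (m : ℝ))
    (e := randomRule) hm hmn hp hp1 hanti (fun _ => le_rfl)
    (by
      simp only [Finset.sum_const, Finset.card_univ, Fintype.card_fin, nsmul_eq_mul]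
      field_simp)
    (fun j => (randomRule_involutive j).injective) (missWeight_randomRule p)
    (missGraph_randomRule_connected hmn)
  rw [← randomMatrix_eq_missMatrix] at hπ hlim ht₀
  have hrandom : ∃ t : ℕ, IsMixingTime (randomMatrix m p) (1 / 2) t ∧
      (t : ℝ) ≤ 12 * mixBound m hmn p := by
    obtain ⟨t, ht, htle⟩ := exists_isMixingTime_le hπ hlim ht₀
    exact ⟨t, ht, (Nat.cast_le.mpr htle).trans hle⟩
  refine ⟨hrandom, ?_, ?_⟩
  · have hφ := sum_randomMatrix_content (m := m) p
    obtain ⟨t, ht, htle⟩ := exists_isMixingTime_le (hπ.lump hφ) (t₀ := t₀) (ε := 1 / 2)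
      (fun u => by
        obtain ⟨x, rfl⟩ := CacheState.content_surjective u
        exact squeeze_zero (fun t => tvDist_nonneg _ _) (fun t => tvDist_lump_le hφ t x) (hlim x))
      (fun u => by
        obtain ⟨x, rfl⟩ := CacheState.content_surjective u
        exact (tvDist_lump_le hφ t₀ x).trans (ht₀ x))
    exact ⟨t, ht, (Nat.cast_le.mpr htle).trans hle⟩
  -- With a single position FIFO and RANDOM coincide, which also covers `n = 2`, where the
  -- connectedness argument for FIFO does not apply.
  · rintro (rfl | hmn2)
    · rw [fifoMatrix_one]
      exact hrandom
    · obtain ⟨π, hπ, hlim, t₀, ht₀, hle⟩ := missMatrix_mixing (c := fun _ : Unit => 1)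
        (e := fun _ => fifoRule hm) hm hmn hp hp1 hanti
        (fun _ => by
          rw [div_le_one (by linarith)]
          exact hm0)
        (by simp) (fun _ => fifoRule_injective hm) (fun _ => missWeight_fifoRule hm p)
        (missGraph_fifoRule_connected hm hmn2)
      rw [← fifoMatrix_eq_missMatrix] at hπ hlim ht₀
      obtain ⟨t, ht, htle⟩ := exists_isMixingTime_le hπ hlim ht₀
      exact ⟨t, ht, (Nat.cast_le.mpr htle).trans hle⟩
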